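/- Let $p$ be an odd prime, let $G=\mathrm{PSL}_2(\mathbb{F}_p)$, and let $k_1,k_2,k_3$ be distinct odd primes, each dividing $|G|$. Let $$\Gamma=\langle x_1,x_2,x_3 \mid x_1^{k_1}=x_2^{k_2}=x_3^{k_3}=x_1x_2x_3=1\rangle .$$ Define polynomials $S_n(t)\in\mathbb{F}_p[t]$ for $n\ge 1$ by $S_1(t)=1$, $S_2(t)=t$, $S_{n+1}(t)=tS_n(t)-S_{n-1}(t)$. Let $$\widetilde{\mathcal{A}}=\{(a,b,c)\in\mathbb{F}_p^3 \mid S_{2k_1}(a)=S_{2k_2}(b)=S_{2k_3}(c)=0,\ S_{2k_1-1}(a)=S_{2k_2-1}(b)=S_{2k_3-1}(c)=-1\},$$ and let $\mathcal{A}=\widetilde{\mathcal{A}}/\!\sim$, where $(a,b,c)\sim(\varepsilon_1a,\varepsilon_2b,\varepsilon_3c)$ for all $\varepsilon_1,\varepsilon_2,\varepsilon_3\in\{1,-1\}$ with $\varepsilon_1\varepsilon_2\varepsilon_3=1$. Let $\mathrm{Hom}(\Gamma,G)/\mathrm{conj}$ be the set of orbits of $G$ acting on the set $\mathrm{Hom}(\Gamma,G)$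 of all group homomorphisms by $(g\cdot f)(x)=g f(x) g^{-1}$. Then $$|\mathrm{Hom}(\Gamma,G)/\mathrm{conj}| = 2|\mathcal{A}|+1,\qquad |\mathrm{Hom}(\Gamma,G)|=(p^3-p)|\mathcal{A}|+1 .$$ -/

import Mathlib

/-- `PSL₂(𝔽_p)`, the quotient of `SL₂(𝔽_p)` by its center. -/
abbrev PSLTwo (p : ℕ) : Type := Matrix.ProjectiveSpecialLinearGroup (Fin 2) (ZMod p)

/-- The relators `x_i ^ k_i` (for `i = 0, 1, 2`) and `x_0 x_1 x_2` in the free group on three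
generators. -/
def triangleRels (k : Fin 3 → ℕ) : Set (FreeGroup (Fin 3)) :=
  (Set.range fun i : Fin 3 => FreeGroup.of i ^ k i) ∪
    {FreeGroup.of 0 * FreeGroup.of 1 * FreeGroup.of 2}

/-- The group `Γ = ⟨x_0, x_1, x_2 | x_i ^ k_i = x_0 x_1 x_2 = 1⟩`. -/
abbrev TriangleGroup (k : Fin 3 → ℕ) : Type := PresentedGroup (triangleRels k)

/-- Two homomorphisms `Γ → G` are conjugate if they differ by an inner automorphism of `G`. -/
def homConj (Γ G : Type*) [Group Γ] [Group G] : Setoid (Γ →* G) where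
  r f f' := ∃ g : G, ∀ x : Γ, f' x = g * f x * g⁻¹
  iseqv :=
    { refl := fun f => ⟨1, fun x => by simp⟩
      symm := by
        rintro f f' ⟨g, hg⟩
        exact ⟨g⁻¹, fun x => by rw [hg]; group⟩
      trans := by
        rintro f f' f'' ⟨g, hg⟩ ⟨g', hg'⟩
        exact ⟨g' * g, fun x => by rw [hg', hg]; group⟩ }

/-- The set `Hom(Γ, G) / conj`. -/
abbrev HomModConj (Γ G : Type*) [Group Γ] [Group G] : Type _ := Quotient (homConj Γ G)

/-- The normalized Chebyshev polynomial `S_n` over `𝔽_p`, indexed so that `S_1 = 1`, `S_2 = t`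
and `S_{n+1} = t S_n - S_{n-1}` (Mathlib's Chebyshev `S` has its index shifted by one). -/
noncomputable def chebS (p : ℕ) (n : ℤ) : Polynomial (ZMod p) :=
  Polynomial.Chebyshev.S (ZMod p) (n - 1)

theorem chebS_one (p : ℕ) : chebS p 1 = 1 := by
  simp [chebS]

theorem chebS_two (p : ℕ) : chebS p 2 = Polynomial.X := by
  simp [chebS]

theorem chebS_add_one (p : ℕ) (n : ℤ) :
    chebS p (n + 1) = Polynomial.X * chebS p n - chebS p (n - 1) := by
  have h := Polynomial.Chebyshev.S_add_one (ZMod p) (n - 1)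
  rw [sub_add_cancel] at h
  simpa [chebS] using h

/-- Triples `(t_0, t_1, t_2) ∈ 𝔽_p³` with `S_{2 k_i}(t_i) = 0` and `S_{2 k_i - 1}(t_i) = -1`
for every `i`. -/
def ChebTriple (p : ℕ) (k : Fin 3 → ℕ) : Type :=
  {t : Fin 3 → ZMod p // ∀ i : Fin 3,
    (chebS p (2 * (k i : ℤ))).eval (t i) = 0 ∧ (chebS p (2 * (k i : ℤ) - 1)).eval (t i) = -1}

/-- Two triples are equivalent if they differ by signs `ε_0, ε_1, ε_2 ∈ {1, -1}` with
`ε_0 ε_1 ε_2 = 1`. -/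
def chebTripleSetoid (p : ℕ) (k : Fin 3 → ℕ) : Setoid (ChebTriple p k) where
  r s t := ∃ ε : Fin 3 → ℤˣ, ∏ i, ε i = 1 ∧ ∀ i, t.1 i = ((ε i : ℤ) : ZMod p) * s.1 i
  iseqv :=
    { refl := fun s => ⟨1, by simp, fun i => by simp⟩
      symm := by
        rintro s t ⟨ε, hε, h⟩
        refine ⟨ε, hε, fun i => ?_⟩
        rw [h i, ← mul_assoc, ← Int.cast_mul, Int.units_coe_mul_self, Int.cast_one, one_mul]
      trans := by
        rintro s t u ⟨ε, hε, h⟩ ⟨δ, hδ, h'⟩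
        refine ⟨δ * ε, by simp [Finset.prod_mul_distrib, hε, hδ], fun i => ?_⟩
        rw [h' i, h i, ← mul_assoc, Pi.mul_apply, Units.val_mul, Int.cast_mul] }

/-- The set `𝒜` of solution triples modulo an even number of sign changes. -/
abbrev ChebClasses (p : ℕ) (k : Fin 3 → ℕ) : Type := Quotient (chebTripleSetoid p k)

/-! A homomorphism from `TriangleGroup k` to `PSLTwo p` is a pair `(X, Y)` with `X ^ k 0 = Y ^ k 1 =
(X * Y) ^ k 2 = 1` (`TriangleGroup.homEquiv`). The exponents are pairwise coprime, so in a
nontrivial pair none of `X`, `Y`, `X * Y` is trivial. The nontrivial pairs are counted through their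
lifts to `SL₂`, four for each pair.

For noncentral `x` in `SL₂`, the power `x ^ k` is central iff `x ^ (2 * k) = 1`, which is the
Chebyshev condition on the trace (`chebRoot_trace_iff`). So the lifts are exactly the pairs whose
traces `a`, `b`, `c` of `x`, `y`, `x * y` form a Chebyshev triple (`chebPairs_eq_preimage`). Such a
triple is never reducible: `fricke a b c = 0` would give eigenvalues `α`, `β`, `α * β` whose squares
have orders dividing three distinct primes, hence `α ^ 2 = β ^ 2 = 1`, and then both `k 0` and `k 1`
would equal `p` (`fricke_ne_zero_of_chebRoot`).

When `fricke a b c ≠ 0`, the pairs with these traces form one nonempty `GL₂`-orbit whose stabilizers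
are the scalars, so there are `|GL₂| / (p - 1) = |SL₂| = p ^ 3 - p` of them. Chebyshev roots are
nonzero, so the four sign changes act freely on triples, and this factor 4 cancels the number of
lifts: there are `(p ^ 3 - p) * |𝒜|` nontrivial homomorphisms. Conjugation acts freely on them, and
`|PSL₂| = (p ^ 3 - p) / 2`, whence `2 * |𝒜|` nontrivial classes. -/

/-! ### Trace identities for pairs in `SL₂`; irreducible pairs -/

section Traces

variable {K : Type*} [Field K]

/-- The polynomial whose vanishing detects reducible pairs in `SL₂` with traces `a`, `b` and
trace `c` of the product. -/
def fricke (a b c : K) : K := a ^ 2 + b ^ 2 + c ^ 2 - a * b * c - 4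

theorem Matrix.sq_eq_trace_smul_sub_one {x : Matrix (Fin 2) (Fin 2) K} (hx : x.det = 1) :
    x * x = x.trace • x - 1 := by
  rw [Matrix.det_fin_two] at hx
  ext i j
  fin_cases i <;> fin_cases j <;>
    simp [Matrix.mul_apply, Fin.sum_univ_two, Matrix.trace_fin_two]
  · linear_combination -hx
  · ring
  · ring
  · linear_combination -hx

/-- The right side is `-det (x * y - y * x)`, written in the 2×2 minors of the traceless parts of
`x` and `y`. -/
theorem fricke_eq_cross_product_form {x y : Matrix (Fin 2) (Fin 2) K} (hx : x.det = 1)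
    (hy : y.det = 1) :
    fricke x.trace y.trace (x * y).trace =
      (x 0 1 * y 1 0 - x 1 0 * y 0 1) ^ 2
      - (x 0 1 * (y 0 0 - y 1 1) - y 0 1 * (x 0 0 - x 1 1)) *
        (x 1 0 * (y 0 0 - y 1 1) - y 1 0 * (x 0 0 - x 1 1)) := by
  rw [Matrix.det_fin_two] at hx hy
  simp only [fricke, Matrix.trace_fin_two, Matrix.mul_apply, Fin.sum_univ_two]
  linear_combination (-(y 0 0 + y 1 1) ^ 2 + 4 * (y 0 0 * y 1 1 - y 0 1 * y 1 0)) * hx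
    + (-(x 0 0 + x 1 1) ^ 2 + 4) * hy

/-- The traceless part of `g` is parallel to those of `x` and `y`, which are independent because
some minor is nonzero. -/
theorem scalar_of_commute {x y g : Matrix (Fin 2) (Fin 2) K} (hx : x.det = 1)
    (hy : y.det = 1) (hxy : fricke x.trace y.trace (x * y).trace ≠ 0)
    (hgx : g * x = x * g) (hgy : g * y = y * g) :
    g 0 1 = 0 ∧ g 1 0 = 0 ∧ g 0 0 = g 1 1 := by
  rw [fricke_eq_cross_product_form hx hy] at hxy
  have e := fun i j => congrFun₂ hgx i j
  have f := fun i j => congrFun₂ hgy i j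
  simp only [Matrix.mul_apply, Fin.sum_univ_two] at e f
  have e00 := e 0 0
  have e01 := e 0 1
  have e10 := e 1 0
  have f00 := f 0 0
  have f01 := f 0 1
  have f10 := f 1 0
  generalize g 0 0 = g1 at *
  generalize g 0 1 = g2 at *
  generalize g 1 0 = g3 at *
  generalize g 1 1 = g4 at *
  generalize x 0 0 = x1 at *
  generalize x 0 1 = x2 at *
  generalize x 1 0 = x3 at *
  generalize x 1 1 = x4 at *
  generalize y 0 0 = y1 at *
  generalize y 0 1 = y2 at *
  generalize y 1 0 = y3 at *
  generalize y 1 1 = y4 at *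
  clear e f hgx hgy
  -- The Fricke value is a form in the three minors, so a scalar killing all three minors is zero.
  have key : ∀ u : K, u * (x2 * y3 - x3 * y2) = 0 →
      u * (x2 * (y1 - y4) - y2 * (x1 - x4)) = 0 →
      u * (x3 * (y1 - y4) - y3 * (x1 - x4)) = 0 → u = 0 := by
    intro u h1 h2 h3
    by_contra hu
    simp only [mul_eq_zero, hu, false_or] at h1 h2 h3
    apply hxy
    rw [h1, h2, h3]
    ring
  refine ⟨key _ ?_ ?_ ?_, key _ ?_ ?_ ?_, sub_eq_zero.1 (key _ ?_ ?_ ?_)⟩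
  · linear_combination x2 * f00 - y2 * e00
  · linear_combination y2 * e01 - x2 * f01
  · linear_combination x2 * f10 + (y1 - y4) * e00 + y3 * e01
  · linear_combination x3 * f00 - y3 * e00
  · linear_combination -(y1 - y4) * e00 - x3 * f01 - y2 * e10
  · linear_combination x3 * f10 - y3 * e10
  · linear_combination -x2 * f10 - (y1 - y4) * e00 - x3 * f01
  · linear_combination (y1 - y4) * e01 - (x1 - x4) * f01
  · linear_combination (x1 - x4) * f10 - (y1 - y4) * e10

theorem charpoly_eval_eq_zero_of_eigenvector {x : Matrix (Fin 2) (Fin 2) K} {v : Fin 2 → K} {α : K}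
    (hx : x.det = 1) (hv : v ≠ 0) (h : x.mulVec v = α • v) :
    α ^ 2 - x.trace * α + 1 = 0 := by
  have h1 := congrArg (fun m => m.mulVec v) (Matrix.sq_eq_trace_smul_sub_one hx)
  simp only [← Matrix.mulVec_mulVec, h, Matrix.mulVec_smul, Matrix.sub_mulVec,
    Matrix.smul_mulVec, Matrix.one_mulVec, smul_smul] at h1
  have h2 : (α ^ 2 - x.trace * α + 1) • v = 0 := by
    rw [add_smul, sub_smul, one_smul, sq, h1]
    abel
  exact (smul_eq_zero.1 h2).resolve_right hv

theorem fricke_eq_zero_of_roots {a b c α β : K} (hα : α ^ 2 - a * α + 1 = 0)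
    (hβ : β ^ 2 - b * β + 1 = 0) (hc : (α * β) ^ 2 - c * (α * β) + 1 = 0) :
    fricke a b c = 0 := by
  have hα0 : α ≠ 0 := by rintro rfl; simp at hα
  have hβ0 : β ≠ 0 := by rintro rfl; simp at hβ
  have ha : a = α + α⁻¹ := by field_simp; linear_combination -hα
  have hb : b = β + β⁻¹ := by field_simp; linear_combination -hβ
  have hc : c = α * β + α⁻¹ * β⁻¹ := by field_simp; linear_combination -hc
  rw [fricke, ha, hb, hc]
  field_simp
  ring

/-- With `a = α + α⁻¹` and `b = β + β⁻¹`, `fricke` factors as a quadratic in `c`; the vanishing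
factor decides between `β` and `β⁻¹`. -/
theorem roots_of_fricke_eq_zero {a b c α β : K} (hα : α ^ 2 - a * α + 1 = 0)
    (hβ : β ^ 2 - b * β + 1 = 0) (h : fricke a b c = 0) :
    ∃ β' : K, β' ^ 2 - b * β' + 1 = 0 ∧ (α * β') ^ 2 - c * (α * β') + 1 = 0 := by
  have hα0 : α ≠ 0 := by rintro rfl; simp at hα
  have hβ0 : β ≠ 0 := by rintro rfl; simp at hβ
  have ha : a = α + α⁻¹ := by field_simp; linear_combination -hα
  have hb : b = β + β⁻¹ := by field_simp; linear_combination -hβ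
  have h1 : (c - (α * β + α⁻¹ * β⁻¹)) * (c - (α * β⁻¹ + α⁻¹ * β)) = 0 := by
    rw [← h, fricke, ha, hb]
    field_simp
    ring
  rcases mul_eq_zero.1 h1 with h2 | h2
  · refine ⟨β, hβ, ?_⟩
    rw [sub_eq_zero.1 h2]
    field_simp
    ring
  · refine ⟨β⁻¹, ?_, ?_⟩
    · rw [hb]
      field_simp
      ring
    · rw [sub_eq_zero.1 h2]
      field_simp
      ring

theorem exists_smul_eq_of_cross_eq_zero {v w : Fin 2 → K} (hv : v ≠ 0)
    (h : v 0 * w 1 = v 1 * w 0) : ∃ α : K, w = α • v := by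
  by_cases h0 : v 0 = 0
  · have h1 : v 1 ≠ 0 := fun h1 => hv (by ext i; fin_cases i <;> simp [h0, h1])
    refine ⟨w 1 / v 1, ?_⟩
    ext i
    fin_cases i
    · have : w 0 = 0 := by simpa [h0, h1] using h
      simp [h0, this]
    · simp [h1]
  · refine ⟨w 0 / v 0, ?_⟩
    ext i
    fin_cases i
    · simp [h0]
    · simp
      field_simp
      linear_combination h

theorem cross_eq_zero_of_mulVec_eq_zero {g : Matrix (Fin 2) (Fin 2) K} {v w : Fin 2 → K}
    (hg : g ≠ 0) (hv : g.mulVec v = 0) (hw : g.mulVec w = 0) : v 0 * w 1 = v 1 * w 0 := by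
  by_contra h
  apply hg
  ext i j
  have e := congrFun hv i
  have f := congrFun hw i
  simp only [Matrix.mulVec, dotProduct, Fin.sum_univ_two, Pi.zero_apply] at e f
  have h' : v 0 * w 1 - v 1 * w 0 ≠ 0 := sub_ne_zero.2 h
  fin_cases j
  · refine (mul_eq_zero.1 (?_ : g i 0 * (v 0 * w 1 - v 1 * w 0) = 0)).resolve_right h'
    linear_combination w 1 * e - v 1 * f
  · refine (mul_eq_zero.1 (?_ : g i 1 * (v 0 * w 1 - v 1 * w 0) = 0)).resolve_right h'
    linear_combination v 0 * f - w 0 * e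

/-- Schur's lemma: the kernel of `g` is stable under `x` and `y`, so if it were a line it would be
spanned by a common eigenvector, forcing `fricke` to vanish. -/
theorem det_ne_zero_of_intertwines {x y x' y' g : Matrix (Fin 2) (Fin 2) K} (hx : x.det = 1)
    (hy : y.det = 1) (hxy : fricke x.trace y.trace (x * y).trace ≠ 0) (hg : g ≠ 0)
    (hgx : g * x = x' * g) (hgy : g * y = y' * g) : g.det ≠ 0 := by
  intro hdet
  obtain ⟨v, hv, hgv⟩ := Matrix.exists_mulVec_eq_zero_iff.2 hdet
  have hkx : g.mulVec (x.mulVec v) = 0 := by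
    rw [Matrix.mulVec_mulVec, hgx, ← Matrix.mulVec_mulVec, hgv, Matrix.mulVec_zero]
  have hky : g.mulVec (y.mulVec v) = 0 := by
    rw [Matrix.mulVec_mulVec, hgy, ← Matrix.mulVec_mulVec, hgv, Matrix.mulVec_zero]
  obtain ⟨α, hα⟩ :=
    exists_smul_eq_of_cross_eq_zero hv (cross_eq_zero_of_mulVec_eq_zero hg hgv hkx)
  obtain ⟨β, hβ⟩ :=
    exists_smul_eq_of_cross_eq_zero hv (cross_eq_zero_of_mulVec_eq_zero hg hgv hky)
  refine hxy (fricke_eq_zero_of_roots (charpoly_eval_eq_zero_of_eigenvector hx hv hα)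
    (charpoly_eval_eq_zero_of_eigenvector hy hv hβ)
    (charpoly_eval_eq_zero_of_eigenvector (v := v) (by rw [Matrix.det_mul, hx, hy, one_mul]) hv ?_))
  rw [← Matrix.mulVec_mulVec, hβ, Matrix.mulVec_smul, hα, smul_smul, mul_comm]

/-- The companion matrix of `X² - a X + 1`. -/
def companion (a : K) : Matrix (Fin 2) (Fin 2) K := !![0, -1; 1, a]

/-- A nonscalar `x` has a cyclic vector `w` among `(1, 0)`, `(0, 1)`, `(1, 1)`; the columns of `P`
are `w` and `x w`. -/
theorem exists_mul_eq_mul_companion {x : Matrix (Fin 2) (Fin 2) K} (hx : x.det = 1)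
    (hs : ¬(x 0 1 = 0 ∧ x 1 0 = 0 ∧ x 0 0 = x 1 1)) :
    ∃ P : Matrix (Fin 2) (Fin 2) K, P.det ≠ 0 ∧ x * P = P * companion x.trace := by
  have key : ∀ u v : K, u * (x 1 0 * u + x 1 1 * v) - v * (x 0 0 * u + x 0 1 * v) ≠ 0 →
      ∃ P : Matrix (Fin 2) (Fin 2) K, P.det ≠ 0 ∧ x * P = P * companion x.trace := by
    intro u v h
    refine ⟨!![u, x 0 0 * u + x 0 1 * v; v, x 1 0 * u + x 1 1 * v], ?_, ?_⟩
    · rw [Matrix.det_fin_two_of]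
      intro h'
      exact h (by linear_combination h')
    · rw [Matrix.det_fin_two] at hx
      ext i j
      fin_cases i <;> fin_cases j <;>
        simp [companion, Matrix.mul_apply, Fin.sum_univ_two, Matrix.trace_fin_two]
      · linear_combination (-u) * hx
      · linear_combination (-v) * hx
  by_cases h1 : x 1 0 = 0
  · by_cases h2 : x 0 1 = 0
    · refine key 1 1 fun h => hs ⟨h2, h1, ?_⟩
      rw [h1, h2] at h
      linear_combination -h
    · refine key 0 1 fun h => h2 ?_
      linear_combination -h
  · refine key 1 0 fun h => h1 ?_
    linear_combination h

/-- The intertwiner is sought as `m • 1 + n • companion a`, which commutes with `companion a`. The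
trace conditions eliminate the top row of `y'`, and equality of determinants makes the remaining
equations for `m`, `n` solvable. -/
theorem exists_intertwiner_companion {a : K} {y y' : Matrix (Fin 2) (Fin 2) K}
    (hy : y.det = 1) (hy' : y'.det = 1) (ht : y.trace = y'.trace)
    (hp : (companion a * y).trace = (companion a * y').trace) :
    ∃ g : Matrix (Fin 2) (Fin 2) K, g ≠ 0 ∧ g * companion a = companion a * g ∧
      g * y = y' * g := by
  have key : ∀ m n : K, (m ≠ 0 ∨ n ≠ 0) →
      (m • (1 : Matrix (Fin 2) (Fin 2) K) + n • companion a) * y =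
        y' * (m • (1 : Matrix (Fin 2) (Fin 2) K) + n • companion a) →
      ∃ g : Matrix (Fin 2) (Fin 2) K, g ≠ 0 ∧ g * companion a = companion a * g ∧
        g * y = y' * g := by
    intro m n hmn h
    refine ⟨_, fun h0 => ?_, ?_, h⟩
    · have h00 := congrFun₂ h0 0 0
      have h10 := congrFun₂ h0 1 0
      simp [companion] at h00 h10
      rcases hmn with h' | h'
      · exact h' h00
      · exact h' h10
    · simp [add_mul, mul_add]
  rw [Matrix.det_fin_two] at hy hy'
  simp only [companion, Matrix.trace_fin_two, Matrix.mul_apply, Fin.sum_univ_two,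
    Matrix.of_apply, Matrix.cons_val', Matrix.cons_val_zero, Matrix.cons_val_one,
    Matrix.cons_val_fin_one] at hp ht
  have h00 : y' 0 0 = y 0 0 + y 1 1 - y' 1 1 := by linear_combination -ht
  have h01 : y' 0 1 = y 0 1 + a * y 1 1 - y 1 0 + y' 1 0 - a * y' 1 1 := by
    linear_combination -hp
  rw [h00, h01] at hy'
  by_cases ht10 : y' 1 0 = y 1 0
  · rw [ht10] at hy' h01
    by_cases ht11 : y' 1 1 = y 1 1
    · have : y = y' := by
        ext i j
        fin_cases i <;> fin_cases j <;> simp [h00, h01, ht10, ht11]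
      exact ⟨1, one_ne_zero, by simp, by rw [← this, one_mul, mul_one]⟩
    · have h : y 0 0 + a * y 1 0 - y' 1 1 = 0 := by
        refine (mul_eq_zero.1 (?_ : (y' 1 1 - y 1 1) * _ = 0)).resolve_left (sub_ne_zero.2 ht11)
        linear_combination hy' - hy
      -- These coefficients solve the lower right entry of `g * y = y' * g`.
      refine key (y 0 1 + a * y 1 1 + y 1 0 - a * y' 1 1) (y' 1 1 - y 1 1)
        (Or.inr (sub_ne_zero.2 ht11)) ?_
      ext i j
      fin_cases i <;> fin_cases j <;>
        simp [companion, Matrix.mul_apply, Fin.sum_univ_two, Matrix.one_apply, h00, h01, ht10]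
      · ring
      · linear_combination (y' 1 1 - y 1 1) * h
      · linear_combination (y' 1 1 - y 1 1) * h
      · ring
  -- Here the coefficients solve the lower left entry.
  · refine key (y 0 0 - y' 1 1 + a * y 1 0) (y' 1 0 - y 1 0)
        (Or.inr (sub_ne_zero.2 ht10)) ?_
    ext i j
    fin_cases i <;> fin_cases j <;>
      simp [companion, Matrix.mul_apply, Fin.sum_univ_two, Matrix.one_apply, h00, h01]
    · linear_combination hy' - hy
    · linear_combination a * hy' - a * hy
    · ring
    · linear_combination hy - hy'

end Traces

/-! ### Pairs with prescribed traces: conjugacy and existence -/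

section Transitivity

variable {K : Type*} [Field K]

theorem exists_conj_companion {x y : Matrix (Fin 2) (Fin 2) K} (hx : x.det = 1)
    (hy : y.det = 1) (hxy : fricke x.trace y.trace (x * y).trace ≠ 0) :
    ∃ (P : GL (Fin 2) K) (z : Matrix (Fin 2) (Fin 2) K), z.det = 1 ∧ z.trace = y.trace ∧
      (companion x.trace * z).trace = (x * y).trace ∧ x * P = P * companion x.trace ∧
      y * P = P * z := by
  obtain ⟨P, hP, hxP⟩ := exists_mul_eq_mul_companion hx (by
    rintro ⟨h1, h2, h3⟩
    apply hxy
    rw [fricke_eq_cross_product_form hx hy, h1, h2, h3]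
    ring)
  let Q : GL (Fin 2) K := Matrix.GeneralLinearGroup.mkOfDetNeZero P hP
  have hQ : (Q : Matrix (Fin 2) (Fin 2) K) = P := rfl
  rw [← hQ] at hxP
  have hc : companion x.trace =
      ((Q⁻¹ : GL (Fin 2) K) : Matrix (Fin 2) (Fin 2) K) * x * Q := by
    rw [mul_assoc, hxP, ← mul_assoc, ← Units.val_mul, inv_mul_cancel, Units.val_one, one_mul]
  refine ⟨Q, ((Q⁻¹ : GL (Fin 2) K) : Matrix (Fin 2) (Fin 2) K) * y * Q, ?_, ?_, ?_, hxP, ?_⟩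
  · rw [Matrix.det_units_conj', hy]
  · rw [Matrix.trace_units_conj']
  · rw [hc]
    have : ((Q⁻¹ : GL (Fin 2) K) : Matrix (Fin 2) (Fin 2) K) * x * Q *
        (((Q⁻¹ : GL (Fin 2) K) : Matrix (Fin 2) (Fin 2) K) * y * Q) =
        ((Q⁻¹ : GL (Fin 2) K) : Matrix (Fin 2) (Fin 2) K) * (x * y) * Q := by
      simp only [mul_assoc, Units.mul_inv_cancel_left]
    rw [this, Matrix.trace_units_conj']
  · simp only [mul_assoc, Units.mul_inv_cancel_left]

theorem exists_intertwiner {x y x' y' : Matrix (Fin 2) (Fin 2) K} (hx : x.det = 1)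
    (hy : y.det = 1) (hx' : x'.det = 1) (hy' : y'.det = 1)
    (hxy : fricke x.trace y.trace (x * y).trace ≠ 0) (h1 : x'.trace = x.trace)
    (h2 : y'.trace = y.trace) (h3 : (x' * y').trace = (x * y).trace) :
    ∃ g : GL (Fin 2) K, (g : Matrix (Fin 2) (Fin 2) K) * x = x' * g ∧
      (g : Matrix (Fin 2) (Fin 2) K) * y = y' * g := by
  obtain ⟨P, z, hz, hzt, hzp, hPx, hPy⟩ := exists_conj_companion hx hy hxy
  obtain ⟨P', z', hz', hzt', hzp', hPx', hPy'⟩ :=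
    exists_conj_companion hx' hy' (by rwa [h1, h2, h3])
  rw [h1] at hzp' hPx'
  obtain ⟨m, hm, hmC, hmz⟩ := exists_intertwiner_companion (a := x.trace) hz hz'
    (by rw [hzt, hzt', h2]) (by rw [hzp, hzp', h3])
  have hdet : ((P' : Matrix (Fin 2) (Fin 2) K) * m *
      ((P⁻¹ : GL (Fin 2) K) : Matrix (Fin 2) (Fin 2) K)).det ≠ 0 := by
    have hCdet : (companion x.trace).det = 1 := by simp [companion, Matrix.det_fin_two]
    have hCtr : (companion x.trace).trace = x.trace := by
      simp [companion, Matrix.trace_fin_two]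
    have hmdet : m.det ≠ 0 :=
      det_ne_zero_of_intertwines hCdet hz (by rwa [hCtr, hzt, hzp]) hm hmC hmz
    rw [Matrix.det_mul, Matrix.det_mul]
    refine mul_ne_zero (mul_ne_zero ?_ hmdet) ?_
    · exact ((Matrix.isUnit_iff_isUnit_det _).1 P'.isUnit).ne_zero
    · exact ((Matrix.isUnit_iff_isUnit_det _).1 (P⁻¹).isUnit).ne_zero
  have key : ∀ {u w w' u' : Matrix (Fin 2) (Fin 2) K}, u * P = P * w → u' * P' = P' * w' →
      m * w = w' * m → (P' : Matrix (Fin 2) (Fin 2) K) * m *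
      ((P⁻¹ : GL (Fin 2) K) : Matrix (Fin 2) (Fin 2) K) * u = u' *
      ((P' : Matrix (Fin 2) (Fin 2) K) * m *
      ((P⁻¹ : GL (Fin 2) K) : Matrix (Fin 2) (Fin 2) K)) := by
    intro u w w' u' e1 e2 e3
    have e4 : ((P⁻¹ : GL (Fin 2) K) : Matrix (Fin 2) (Fin 2) K) * u =
        w * ((P⁻¹ : GL (Fin 2) K) : Matrix (Fin 2) (Fin 2) K) := by
      rw [Units.eq_mul_inv_iff_mul_eq, mul_assoc, e1, Units.inv_mul_cancel_left]
    rw [mul_assoc, e4, ← mul_assoc, mul_assoc (P' : Matrix (Fin 2) (Fin 2) K), e3,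
      ← mul_assoc (P' : Matrix (Fin 2) (Fin 2) K), ← e2]
    simp only [mul_assoc]
  exact ⟨Matrix.GeneralLinearGroup.mkOfDetNeZero _ hdet, key hPx hPx' hmC, key hPy hPy' hmz⟩

-- The two trace conditions leave a two-parameter family of matrices `y`; the condition `det y = 1`
-- cuts out a conic, which has a point over a finite field of odd order.
open Polynomial in
theorem exists_companion_complement [Fintype K] (h2 : (2 : K) ≠ 0)
    (hcard : Fintype.card K % 2 = 1) {a b c : K} (h : fricke a b c ≠ 0) :
    ∃ y : Matrix (Fin 2) (Fin 2) K, y.det = 1 ∧ y.trace = b ∧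
      (companion a * y).trace = c := by
  have key : ∀ t w : K, w ^ 2 + ((4 - a ^ 2) * t ^ 2 + (4 * c - 2 * a * b) * t + (4 - b ^ 2)) = 0 →
      ∃ y : Matrix (Fin 2) (Fin 2) K, y.det = 1 ∧ y.trace = b ∧
      (companion a * y).trace = c := by
    intro t w hw
    -- This substitution completes the square in `4 * det y = 4`, with `u` and `t` the bottom row of
    -- `y`.
    obtain ⟨u, rfl⟩ : ∃ u, w = 2 * u - a * t - b := ⟨(w + a * t + b) / 2, by field_simp; ring⟩
    refine ⟨!![b - u, c + t - a * u; t, u], ?_, ?_, ?_⟩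
    · rw [Matrix.det_fin_two_of]
      have h4 : (2 * 2 : K) ≠ 0 := mul_ne_zero h2 h2
      apply mul_left_cancel₀ h4
      linear_combination -hw
    · simp [Matrix.trace_fin_two]
    · simp [companion, Matrix.trace_fin_two]
  by_cases ha : 4 - a ^ 2 = 0
  -- If `a ^ 2 = 4`, the equation is linear in `t` for `w = 0`; its slope is nonzero since `4 *
  -- fricke a b c = (2 * c - a * b) ^ 2 + (b ^ 2 - 4) * (4 - a ^ 2)`.
  · have hl : 4 * c - 2 * a * b ≠ 0 := by
      intro hl
      have hl' : 2 * c - a * b = 0 :=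
        (mul_eq_zero.1 (by linear_combination hl : 2 * (2 * c - a * b) = 0)).resolve_left h2
      refine h ((mul_eq_zero.1 (?_ : (2 * 2) * fricke a b c = 0)).resolve_left
        (mul_ne_zero h2 h2))
      rw [fricke]
      linear_combination (2 * c - a * b) * hl' + (b ^ 2 - 4) * ha
    obtain ⟨t, ht⟩ : ∃ t, (4 * c - 2 * a * b) * t = -(4 - b ^ 2) :=
      ⟨_, mul_div_cancel₀ _ hl⟩
    refine key t 0 ?_
    linear_combination ht + t ^ 2 * ha
  · obtain ⟨w, t, hwt⟩ := FiniteField.exists_root_sum_quadratic (f := (X ^ 2 : K[X]))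
      (g := C (4 - a ^ 2) * X ^ 2 + C (4 * c - 2 * a * b) * X + C (4 - b ^ 2))
      (degree_X_pow 2) (degree_quadratic ha) hcard
    refine key t w ?_
    simpa using hwt

end Transitivity

/-! ### Counting with freely parametrized classes -/

/-- If `act` parametrizes each class of `s` in `Q` injectively by `G`, then the union of the
classes in `Q` has `|G|` times as many elements as `Q`. -/
theorem Setoid.card_preimage_of_free {X G : Type*} (s : Setoid X) (act : G → X → X)
    (h : ∀ x y, s x y ↔ ∃ g, y = act g x) (Q : Set (Quotient s))
    (hinj : ∀ x, (Quotient.mk s x) ∈ Q → Function.Injective fun g => act g x) :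
    Nat.card {x : X // Quotient.mk s x ∈ Q} = Nat.card G * Nat.card Q := by
  rw [← Nat.card_prod]
  symm
  have hmk : ∀ (g : G) (x : X), Quotient.mk s (act g x) = Quotient.mk s x := fun g x =>
    Quotient.sound (s.symm ((h _ _).2 ⟨g, rfl⟩))
  refine Nat.card_congr (Equiv.ofBijective
    (fun q : G × Q => (⟨act q.1 q.2.1.out, by rw [hmk, Quotient.out_eq]; exact q.2.2⟩ :
      {x : X // Quotient.mk s x ∈ Q})) ⟨?_, ?_⟩)
  · rintro ⟨g, q, hq⟩ ⟨g', q', hq'⟩ e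
    have e := congrArg Subtype.val e
    simp only at e
    have e' := congrArg (Quotient.mk s) e
    rw [hmk, hmk, Quotient.out_eq, Quotient.out_eq] at e'
    subst e'
    rw [hinj q.out (by rwa [Quotient.out_eq]) e]
  · rintro ⟨x, hx⟩
    obtain ⟨g, hg⟩ := (h (Quotient.mk s x).out x).1 (Quotient.mk_out x)
    exact ⟨⟨g, ⟨_, hx⟩⟩, Subtype.ext hg.symm⟩

theorem Setoid.card_of_free {X G : Type*} (s : Setoid X) (act : G → X → X)
    (h : ∀ x y, s x y ↔ ∃ g, y = act g x) (hinj : ∀ x, Function.Injective fun g => act g x) :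
    Nat.card X = Nat.card G * Nat.card (Quotient s) := by
  have := Setoid.card_preimage_of_free s act h Set.univ fun x _ => hinj x
  rwa [Nat.card_congr (Equiv.subtypeUnivEquiv fun _ => Set.mem_univ _), Nat.card_coe_set_eq,
    Set.ncard_univ] at this

theorem MonoidHom.card_preimage {A B : Type*} [Group A] [Group B] (f : A →* B)
    (hf : Function.Surjective f) (S : Set B) :
    Nat.card (f ⁻¹' S) = Nat.card f.ker * Nat.card S := by
  have := Setoid.card_preimage_of_free (Setoid.ker f) (fun (g : f.ker) x => x * g)
    (fun x y => ?_) ((Setoid.quotientKerEquivOfSurjective f hf) ⁻¹' S) fun x _ g g' e =>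
      Subtype.ext (mul_left_cancel e)
  · refine Eq.trans this (congrArg (Nat.card f.ker * ·) (Nat.card_congr ?_))
    exact (Setoid.quotientKerEquivOfSurjective f hf).subtypeEquiv fun _ => Iff.rfl
  · rw [Setoid.ker_def]
    constructor
    · intro e
      exact ⟨⟨x⁻¹ * y, by simp [MonoidHom.mem_ker, e]⟩, by simp⟩
    · rintro ⟨⟨g, hg⟩, rfl⟩
      simp [MonoidHom.mem_ker.1 hg]

/-! ### The number of pairs in `SL₂` with given traces -/

section Counting

variable {K : Type*} [Field K]

open Matrix

/-- Conjugation of elements of `SL₂` by elements of `GL₂`. -/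
def glConj (g : GL (Fin 2) K) (x : SpecialLinearGroup (Fin 2) K) :
    SpecialLinearGroup (Fin 2) K :=
  ⟨(g : Matrix (Fin 2) (Fin 2) K) * x * ((g⁻¹ : GL (Fin 2) K) : Matrix (Fin 2) (Fin 2) K), by
    rw [Matrix.det_units_conj, x.2]⟩

theorem glConj_eq_iff {g : GL (Fin 2) K} {x y : SpecialLinearGroup (Fin 2) K} :
    glConj g x = y ↔ (g : Matrix (Fin 2) (Fin 2) K) * x = y * g :=
  Subtype.ext_iff.trans (Units.mul_inv_eq_iff_eq_mul _)

/-- Pairs in `SL₂` with traces `a` and `b`, and with trace `c` of the product. -/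
def TracePairs (a b c : K) : Set (SpecialLinearGroup (Fin 2) K × SpecialLinearGroup (Fin 2) K) :=
  {q | q.1.1.trace = a ∧ q.2.1.trace = b ∧ (q.1 * q.2).1.trace = c}

/-- Orbit–stabilizer for `GL₂` acting by simultaneous conjugation: `exists_intertwiner` gives
transitivity and `scalar_of_commute` shows that the stabilizer is the group of scalars. -/
theorem card_units_mul_card_tracePairs [Fintype K] (h2 : (2 : K) ≠ 0)
    (hcard : Fintype.card K % 2 = 1) {a b c : K} (h : fricke a b c ≠ 0) :
    Nat.card (GL (Fin 2) K) = Nat.card Kˣ * Nat.card (TracePairs a b c) := by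
  obtain ⟨y₀, hy, rfl, rfl⟩ := exists_companion_complement h2 hcard h
  have hx : (companion a).det = 1 := by simp [companion, Matrix.det_fin_two]
  have ht : (companion a).trace = a := by simp [companion, Matrix.trace_fin_two]
  generalize companion a = x₀ at *
  subst ht
  let x : SpecialLinearGroup (Fin 2) K := ⟨x₀, hx⟩
  let y : SpecialLinearGroup (Fin 2) K := ⟨y₀, hy⟩
  let φ : GL (Fin 2) K → TracePairs x₀.trace y₀.trace (x₀ * y₀).trace := fun g =>
    ⟨(glConj g x, glConj g y), by
      refine ⟨?_, ?_, ?_⟩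
      · exact Matrix.trace_units_conj g x₀
      · exact Matrix.trace_units_conj g y₀
      · have : glConj g x * glConj g y = glConj g (x * y) := by
          refine (glConj_eq_iff.2 ?_).symm
          change (g : Matrix (Fin 2) (Fin 2) K) * (x * y) = glConj g x * glConj g y * g
          rw [mul_assoc, ← glConj_eq_iff.1 (rfl : glConj g y = _), ← mul_assoc,
            glConj_eq_iff.1 (rfl : glConj g x = _), mul_assoc]
        rw [this]
        exact Matrix.trace_units_conj g (x₀ * y₀)⟩
  have hφ : Function.Surjective φ := by
    rintro ⟨⟨x', y'⟩, h1, h2, h3⟩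
    obtain ⟨g, hg1, hg2⟩ := exists_intertwiner (x := x₀) (y := y₀) hx hy x'.2 y'.2 h h1 h2 h3
    exact ⟨g, Subtype.ext (Prod.ext (glConj_eq_iff.2 hg1) (glConj_eq_iff.2 hg2))⟩
  rw [← Nat.card_congr (Setoid.quotientKerEquivOfSurjective φ hφ)]
  refine Setoid.card_of_free _ (fun u g => g * GeneralLinearGroup.scalar (Fin 2) u) ?_ ?_
  · intro g g'
    rw [Setoid.ker_def]
    constructor
    · intro e
      have e1 := congrArg (fun q => (q.1.1 : Matrix (Fin 2) (Fin 2) K)) e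
      have e2 := congrArg (fun q => (q.1.2 : Matrix (Fin 2) (Fin 2) K)) e
      have key : ∀ z : Matrix (Fin 2) (Fin 2) K,
          (g : Matrix (Fin 2) (Fin 2) K) * z * ((g⁻¹ : GL (Fin 2) K) : Matrix (Fin 2) (Fin 2) K) =
          g' * z * ((g'⁻¹ : GL (Fin 2) K) : Matrix (Fin 2) (Fin 2) K) →
          ((g⁻¹ * g' : GL (Fin 2) K) : Matrix (Fin 2) (Fin 2) K) * z =
          z * ((g⁻¹ * g' : GL (Fin 2) K) : Matrix (Fin 2) (Fin 2) K) := by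
        intro z hz
        rw [Units.val_mul, mul_assoc, Units.inv_mul_eq_iff_eq_mul, ← mul_assoc, ← mul_assoc, hz,
          mul_assoc _ _ (g' : Matrix (Fin 2) (Fin 2) K)]
        simp
      obtain ⟨s1, s2, s3⟩ := scalar_of_commute hx hy h (key _ e1) (key _ e2)
      have hd := ((Matrix.isUnit_iff_isUnit_det _).1 (g⁻¹ * g').isUnit).ne_zero
      rw [Matrix.det_fin_two, s1, s3] at hd
      have hu : ((g⁻¹ * g' : GL (Fin 2) K) : Matrix (Fin 2) (Fin 2) K) 1 1 ≠ 0 := by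
        intro h0
        simp [h0] at hd
      refine ⟨Units.mk0 _ hu, ?_⟩
      rw [← inv_mul_eq_iff_eq_mul]
      ext i j
      fin_cases i <;> fin_cases j
      · simpa using s3
      · simpa using s1
      · simpa using s2
      · simp
    · rintro ⟨u, rfl⟩
      have : ∀ z, glConj (g * GeneralLinearGroup.scalar (Fin 2) u) z = glConj g z := by
        intro z
        have hs : ((GeneralLinearGroup.scalar (Fin 2) u : GL (Fin 2) K) :
            Matrix (Fin 2) (Fin 2) K) * z = z * (GeneralLinearGroup.scalar (Fin 2) u : GL (Fin 2) K) :=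
          Matrix.scalar_commute (u : K) (fun _ => mul_comm _ _) z.1
        rw [glConj_eq_iff, Units.val_mul, mul_assoc, hs, ← mul_assoc,
          glConj_eq_iff.1 (rfl : glConj g z = _), mul_assoc]
      exact Subtype.ext (Prod.ext (this x).symm (this y).symm)
  · intro g u v e
    have e := mul_left_cancel e
    have := congrArg (fun m : GL (Fin 2) K => (m : Matrix (Fin 2) (Fin 2) K) 0 0) e
    exact Units.ext (by simpa using this)

end Counting

/-! ### The center of `SL₂` and the order of `SL₂` -/

section Center

open Matrix

variable {K : Type*} [Field K]

theorem SL2.mem_center_iff_entries {x : SpecialLinearGroup (Fin 2) K} :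
    x ∈ Subgroup.center (SpecialLinearGroup (Fin 2) K) ↔
      x.1 0 1 = 0 ∧ x.1 1 0 = 0 ∧ x.1 0 0 = x.1 1 1 := by
  constructor
  · intro hx
    have h : scalar (Fin 2) (x.1 0 0) = x.1 :=
      SpecialLinearGroup.scalar_eq_self_of_mem_center hx 0
    generalize x.1 0 0 = r at h
    rw [← h]
    simp
  · rintro ⟨h1, h2, h3⟩
    have hd := x.2
    rw [Matrix.det_fin_two, h1, h3] at hd
    refine Matrix.SpecialLinearGroup.mem_center_iff.2 ⟨x.1 1 1, ?_, ?_⟩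
    · rw [Fintype.card_fin]
      linear_combination hd
    · ext i j
      fin_cases i <;> fin_cases j
      · simpa using h3.symm
      · simpa using h1.symm
      · simpa using h2.symm
      · simp

theorem SL2.mem_center_iff_eq {x : SpecialLinearGroup (Fin 2) K} :
    x ∈ Subgroup.center (SpecialLinearGroup (Fin 2) K) ↔ x = 1 ∨ x = -1 := by
  rw [SL2.mem_center_iff_entries]
  constructor
  · rintro ⟨h1, h2, h3⟩
    have hd := x.2
    rw [Matrix.det_fin_two, h1, h3] at hd
    have hd : (x.1 1 1 - 1) * (x.1 1 1 + 1) = 0 := by linear_combination hd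
    rcases mul_eq_zero.1 hd with h | h
    · left
      have h11 : x.1 1 1 = 1 := sub_eq_zero.1 h
      ext i j
      fin_cases i <;> fin_cases j
      · exact h3.trans h11
      · exact h1
      · exact h2
      · exact h11
    · right
      have h11 : x.1 1 1 = -1 := eq_neg_of_add_eq_zero_left h
      ext i j
      fin_cases i <;> fin_cases j
      · simpa using h3.trans h11
      · simpa using h1
      · simpa using h2
      · simpa using h11
  · rintro (rfl | rfl) <;> simp

/-- If `x ^ 2 = 1`, Cayley–Hamilton reads `tr(x) • x = 2`, so `tr(x) ≠ 0` and `x` is scalar. -/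
theorem SL2.mem_center_iff_sq (h2 : (2 : K) ≠ 0) {x : SpecialLinearGroup (Fin 2) K} :
    x ∈ Subgroup.center (SpecialLinearGroup (Fin 2) K) ↔ x ^ 2 = 1 := by
  constructor
  · intro h
    rcases SL2.mem_center_iff_eq.1 h with rfl | rfl <;> simp
  · intro h
    have h1 : x.1 * x.1 = 1 := by
      rw [sq] at h
      exact congrArg Subtype.val h
    have h3 := Matrix.sq_eq_trace_smul_sub_one x.2
    rw [h1] at h3
    have e := fun i j => congrFun₂ h3 i j
    have e00 := e 0 0
    have e01 := e 0 1
    have e10 := e 1 0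
    have e11 := e 1 1
    simp at e00 e01 e10 e11
    have ht : x.1.trace ≠ 0 := by
      intro h0
      rw [h0] at e00
      exact h2 (by linear_combination e00)
    refine SL2.mem_center_iff_entries.2 ⟨e01.resolve_left ht, e10.resolve_left ht, ?_⟩
    exact mul_left_cancel₀ ht (by linear_combination e11 - e00)

theorem SL2.card_center (h2 : (2 : K) ≠ 0) :
    Nat.card (Subgroup.center (SpecialLinearGroup (Fin 2) K)) = 2 := by
  have : ((Subgroup.center (SpecialLinearGroup (Fin 2) K) : Subgroup (SpecialLinearGroup (Fin 2) K)) :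
      Set (SpecialLinearGroup (Fin 2) K)) = {1, -1} := by
    ext x
    exact SL2.mem_center_iff_eq
  have h1 : (1 : SpecialLinearGroup (Fin 2) K) ≠ -1 := by
    intro h
    have := congrArg (fun x => x.1 0 0) h
    simp at this
    exact h2 (by linear_combination this)
  change Nat.card ((Subgroup.center (SpecialLinearGroup (Fin 2) K) :
    Subgroup (SpecialLinearGroup (Fin 2) K)) : Set (SpecialLinearGroup (Fin 2) K)) = 2
  rw [this, Nat.card_coe_set_eq, Set.ncard_pair h1]

theorem card_GL_eq_card_units_mul_card_SL (K : Type*) [Field K] :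
    Nat.card (GL (Fin 2) K) = Nat.card Kˣ * Nat.card (SpecialLinearGroup (Fin 2) K) := by
  have hs : Function.Surjective (GeneralLinearGroup.det : GL (Fin 2) K →* Kˣ) := by
    intro u
    refine ⟨GeneralLinearGroup.mkOfDetNeZero !![(u : K), 0; 0, 1] (by simp), ?_⟩
    ext
    simp [GeneralLinearGroup.mkOfDetNeZero]
  have h := MonoidHom.card_preimage GeneralLinearGroup.det hs Set.univ
  have hker : Nat.card (SpecialLinearGroup (Fin 2) K) =
      Nat.card (GeneralLinearGroup.det : GL (Fin 2) K →* Kˣ).ker := by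
    refine Nat.card_congr (Equiv.ofBijective (fun x => ⟨(x : GL (Fin 2) K), ?_⟩) ⟨?_, ?_⟩)
    · rw [MonoidHom.mem_ker]
      ext
      simp
    · intro x y e
      have := congrArg (fun z => (z.1 : Matrix (Fin 2) (Fin 2) K)) e
      exact Subtype.ext this
    · rintro ⟨g, hg⟩
      have hg' : (g : Matrix (Fin 2) (Fin 2) K).det = 1 := congrArg Units.val hg
      exact ⟨⟨g, hg'⟩, Subtype.ext (Units.ext rfl)⟩
  rw [hker, mul_comm]
  simpa using h

end Center

/-! ### Chebyshev conditions as torsion conditions -/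

section Chebyshev

variable {p : ℕ}

/-- Stated for an arbitrary algebra so as to apply both to matrices and to their eigenvalues in an
extension field. The case `n = 0` uses `S_0 = 0` and `S_{-1} = -1`. -/
theorem pow_eq_chebS {A : Type*} [Ring A] [Algebra (ZMod p) A] {a : A} {t : ZMod p}
    (h : a * a = t • a - 1) (n : ℕ) :
    a ^ n = ((chebS p n).eval t) • a - ((chebS p (n - 1)).eval t) • (1 : A) := by
  induction n with
  | zero =>
    simp [chebS]
  | succ n ih =>
    rw [pow_succ, ih, sub_mul, smul_mul_assoc, h, smul_mul_assoc, one_mul, Nat.cast_add,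
      Nat.cast_one, chebS_add_one, add_sub_cancel_right, Polynomial.eval_sub,
      Polynomial.eval_mul, Polynomial.eval_X]
    module

/-- The Chebyshev condition on a single coordinate of a triple in `ChebTriple`. -/
def ChebRoot (p k : ℕ) (t : ZMod p) : Prop :=
  (chebS p (2 * (k : ℤ))).eval t = 0 ∧ (chebS p (2 * (k : ℤ) - 1)).eval t = -1

theorem ChebRoot.pow_eq_one {A : Type*} [Ring A] [Algebra (ZMod p) A] {a : A} {k : ℕ}
    {t : ZMod p} (ht : ChebRoot p k t) (h : a * a = t • a - 1) : a ^ (2 * k) = 1 := by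
  rw [pow_eq_chebS h, Nat.cast_mul, Nat.cast_ofNat, ht.1, ht.2]
  simp

variable [Fact p.Prime]

open Matrix

/-- For noncentral `x`, the matrices `1` and `x` are linearly independent, so the coefficients of `x
^ (2 * k)` in `pow_eq_chebS` can be read off. -/
theorem chebRoot_trace_iff (h2 : (2 : ZMod p) ≠ 0) {x : SpecialLinearGroup (Fin 2) (ZMod p)}
    (hx : x ∉ Subgroup.center (SpecialLinearGroup (Fin 2) (ZMod p))) {k : ℕ} :
    ChebRoot p k x.1.trace ↔ x ^ k ∈ Subgroup.center (SpecialLinearGroup (Fin 2) (ZMod p)) := by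
  rw [SL2.mem_center_iff_sq h2, ← pow_mul, mul_comm k]
  constructor
  · intro h
    exact Subtype.ext (h.pow_eq_one (Matrix.sq_eq_trace_smul_sub_one x.2))
  · intro h
    have h1 : x.1 ^ (2 * k) = 1 := congrArg Subtype.val h
    have h3 := pow_eq_chebS (Matrix.sq_eq_trace_smul_sub_one x.2) (2 * k)
    rw [h1, Nat.cast_mul, Nat.cast_ofNat] at h3
    rw [ChebRoot]
    generalize (chebS p (2 * (k : ℤ))).eval x.1.trace = u at *
    generalize (chebS p (2 * (k : ℤ) - 1)).eval x.1.trace = v at *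
    have e := fun i j => congrFun₂ h3 i j
    have e00 := e 0 0
    have e01 := e 0 1
    have e10 := e 1 0
    have e11 := e 1 1
    simp at e00 e01 e10 e11
    have hu : u = 0 := by
      by_contra hu
      refine hx (SL2.mem_center_iff_entries.2
        ⟨e01.resolve_left hu, e10.resolve_left hu, mul_left_cancel₀ hu ?_⟩)
      linear_combination e11 - e00
    refine ⟨hu, ?_⟩
    rw [hu] at e11
    linear_combination e11

theorem exists_root_algebraicClosure {t : ZMod p} :
    ∃ α : AlgebraicClosure (ZMod p), α ^ 2 - algebraMap _ _ t * α + 1 = 0 := by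
  let q : Polynomial (AlgebraicClosure (ZMod p)) := Polynomial.C 1 * Polynomial.X ^ 2 +
    Polynomial.C (-algebraMap (ZMod p) (AlgebraicClosure (ZMod p)) t) * Polynomial.X +
    Polynomial.C 1
  obtain ⟨α, hα⟩ := IsAlgClosed.exists_root q
    (by rw [Polynomial.degree_quadratic one_ne_zero]; norm_num)
  refine ⟨α, ?_⟩
  simp [q] at hα
  linear_combination hα

theorem ChebRoot.root_pow_eq_one {K : Type*} [Field K] [Algebra (ZMod p) K] {α : K} {k : ℕ}
    {t : ZMod p} (ht : ChebRoot p k t) (h : α ^ 2 - algebraMap _ _ t * α + 1 = 0) :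
    (α ^ 2) ^ k = 1 := by
  rw [← pow_mul]
  refine ht.pow_eq_one ?_
  rw [Algebra.smul_def]
  linear_combination h

/-- Trace zero means `α ^ 2 = -1`, whose odd powers are never 1. -/
theorem ChebRoot.ne_zero (h2 : (2 : ZMod p) ≠ 0) {k : ℕ} (hk : Odd k) {t : ZMod p}
    (ht : ChebRoot p k t) : t ≠ 0 := by
  rintro rfl
  obtain ⟨α, hα⟩ := exists_root_algebraicClosure (t := (0 : ZMod p))
  have h1 := ht.root_pow_eq_one hα
  have h3 : α ^ 2 = -1 := by
    rw [map_zero] at hα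
    linear_combination hα
  rw [h3, hk.neg_one_pow] at h1
  apply h2
  apply (algebraMap (ZMod p) (AlgebraicClosure (ZMod p))).injective
  rw [map_zero, map_ofNat]
  linear_combination -h1

theorem chebS_eval_neg (t : ZMod p) (n : ℕ) :
    (chebS p (2 * (n : ℤ))).eval (-t) = -(chebS p (2 * (n : ℤ))).eval t ∧
      (chebS p (2 * (n : ℤ) - 1)).eval (-t) = (chebS p (2 * (n : ℤ) - 1)).eval t := by
  induction n with
  | zero => simp [chebS]
  | succ n ih =>
    have h1 : chebS p (2 * ((n + 1 : ℕ) : ℤ) - 1) =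
        Polynomial.X * chebS p (2 * (n : ℤ)) - chebS p (2 * (n : ℤ) - 1) := by
      rw [← chebS_add_one]
      congr 1
      push_cast
      ring
    have h2 : chebS p (2 * ((n + 1 : ℕ) : ℤ)) =
        Polynomial.X * chebS p (2 * ((n + 1 : ℕ) : ℤ) - 1) - chebS p (2 * (n : ℤ)) := by
      have := chebS_add_one p (2 * ((n + 1 : ℕ) : ℤ) - 1)
      rw [sub_add_cancel] at this
      rw [this]
      congr 2
      push_cast
      ring
    rw [h2, h1]
    simp only [Polynomial.eval_sub, Polynomial.eval_mul, Polynomial.eval_X, ih.1, ih.2]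
    constructor <;> ring

theorem ChebRoot.neg {k : ℕ} {t : ZMod p} (ht : ChebRoot p k t) : ChebRoot p k (-t) := by
  rw [ChebRoot, (chebS_eval_neg t k).1, (chebS_eval_neg t k).2, ht.1, ht.2, neg_zero]
  exact ⟨rfl, rfl⟩

/-- Up to sign `t = 2`, and `S_{2k}(2) = 2k` vanishes only if `p` divides `k`. -/
theorem ChebRoot.eq_of_sq_eq_one (h2 : (2 : ZMod p) ≠ 0) {k : ℕ} (hk : k.Prime) {t : ZMod p}
    (ht : ChebRoot p k t) (hs : t ^ 2 = 4) : k = p := by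
  wlog h : t = 2 generalizing t
  · refine this ht.neg (by rw [neg_sq, hs]) ?_
    have : (t - 2) * (t + 2) = 0 := by linear_combination hs
    rcases mul_eq_zero.1 this with h' | h'
    · exact absurd (sub_eq_zero.1 h') h
    · linear_combination -h'
  subst h
  have h1 := ht.1
  rw [chebS, Polynomial.Chebyshev.S_eval_two] at h1
  have h3 : (k : ZMod p) = 0 := by
    refine (mul_eq_zero.1 (?_ : (2 : ZMod p) * k = 0)).resolve_left h2
    push_cast at h1
    linear_combination h1
  rw [ZMod.natCast_eq_zero_iff] at h3
  exact ((Nat.prime_dvd_prime_iff_eq Fact.out hk).1 h3).symm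

theorem eq_one_of_pow_eq_one {G : Type*} [Monoid G] {x : G} {m n : ℕ} (h : m.Coprime n)
    (hm : x ^ m = 1) (hn : x ^ n = 1) : x = 1 := by
  have := pow_gcd_eq_one.2 ⟨hm, hn⟩
  rwa [h, pow_one] at this

theorem fricke_ne_zero_of_chebRoot (h2 : (2 : ZMod p) ≠ 0) {k l m : ℕ} (hk : k.Prime)
    (hl : l.Prime) (hm : m.Prime) (hkl : k ≠ l) (hkm : k ≠ m) (hlm : l ≠ m) {a b c : ZMod p}
    (ha : ChebRoot p k a) (hb : ChebRoot p l b) (hc : ChebRoot p m c) : fricke a b c ≠ 0 := by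
  intro h
  let f := algebraMap (ZMod p) (AlgebraicClosure (ZMod p))
  obtain ⟨α, hα⟩ := exists_root_algebraicClosure (t := a)
  obtain ⟨β₀, hβ₀⟩ := exists_root_algebraicClosure (t := b)
  have h' : fricke (f a) (f b) (f c) = 0 := by
    have := congrArg f h
    rw [fricke, map_sub, map_ofNat] at this
    simpa [fricke, map_ofNat] using this
  obtain ⟨β, hβ, hαβ⟩ := roots_of_fricke_eq_zero hα hβ₀ h'
  have h1 := ha.root_pow_eq_one hα
  have h3 := hb.root_pow_eq_one hβ
  have h4 := hc.root_pow_eq_one hαβ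
  rw [mul_pow, mul_pow] at h4
  have ckl := (Nat.coprime_primes hk hl).2 hkl
  have ckm := (Nat.coprime_primes hk hm).2 hkm
  have clm := (Nat.coprime_primes hl hm).2 hlm
  -- Raising `(α * β) ^ (2 * m) = 1` to the power `l` removes `β`, so the order of `α ^ 2` divides
  -- both `k` and `m * l`.
  have hα1 : α ^ 2 = 1 := by
    refine eq_one_of_pow_eq_one (ckm.mul_right ckl) h1 ?_
    have := congrArg (· ^ l) h4
    simp only [mul_pow, one_pow] at this
    rwa [← pow_mul (β ^ 2), mul_comm m l, pow_mul (β ^ 2), h3, one_pow, mul_one,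
      ← pow_mul] at this
  have hβ1 : β ^ 2 = 1 := by
    rw [hα1, one_pow, one_mul] at h4
    exact eq_one_of_pow_eq_one clm h3 h4
  have key : ∀ {γ : AlgebraicClosure (ZMod p)} {t : ZMod p}, γ ^ 2 - f t * γ + 1 = 0 →
      γ ^ 2 = 1 → t ^ 2 = 4 := by
    intro γ t e1 e2
    apply f.injective
    rw [map_pow, map_ofNat]
    linear_combination (f t * γ + 2) * (-e1) - (f t) ^ 2 * e2 + (f t * γ + 2) * e2
  exact hkl ((ha.eq_of_sq_eq_one h2 hk (key hα hα1)).trans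
    (hb.eq_of_sq_eq_one h2 hl (key hβ hβ1)).symm)

end Chebyshev

/-! ### Homomorphisms from the triangle group as pairs -/

section TriangleGroup

/-- Pairs satisfying the relations of the first two generators of a triangle group. -/
def RelPairs (k : Fin 3 → ℕ) (G : Type*) [Group G] : Set (G × G) :=
  {q | q.1 ^ k 0 = 1 ∧ q.2 ^ k 1 = 1 ∧ (q.1 * q.2) ^ k 2 = 1}

variable {k : Fin 3 → ℕ} {G : Type*} [Group G]

theorem TriangleGroup.of_pow (k : Fin 3 → ℕ) (i : Fin 3) :
    (PresentedGroup.of i : TriangleGroup k) ^ k i = 1 :=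
  PresentedGroup.one_of_mem (rels := triangleRels k) (Or.inl ⟨i, rfl⟩)

theorem TriangleGroup.of_mul_of_mul_of (k : Fin 3 → ℕ) :
    (PresentedGroup.of 0 * PresentedGroup.of 1 * PresentedGroup.of 2 : TriangleGroup k) = 1 :=
  PresentedGroup.one_of_mem (rels := triangleRels k) (Or.inr rfl)

theorem TriangleGroup.map_of_two (f : TriangleGroup k →* G) :
    f (PresentedGroup.of 2) = (f (PresentedGroup.of 0) * f (PresentedGroup.of 1))⁻¹ := by
  rw [eq_comm, inv_eq_iff_mul_eq_one,
    ← map_mul, ← map_mul, TriangleGroup.of_mul_of_mul_of, map_one]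

theorem TriangleGroup.hom_ext {f f' : TriangleGroup k →* G}
    (h0 : f (PresentedGroup.of 0) = f' (PresentedGroup.of 0))
    (h1 : f (PresentedGroup.of 1) = f' (PresentedGroup.of 1)) : f = f' := by
  refine PresentedGroup.ext fun i => ?_
  fin_cases i
  · exact h0
  · exact h1
  · exact (map_of_two f).trans (by rw [h0, h1]; exact (map_of_two f').symm)

/-- Homomorphisms out of a triangle group as pairs of elements. -/
noncomputable def TriangleGroup.homEquiv (k : Fin 3 → ℕ) (G : Type*) [Group G] :
    (TriangleGroup k →* G) ≃ RelPairs k G :=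
  Equiv.ofBijective
    (fun f => ⟨(f (PresentedGroup.of 0), f (PresentedGroup.of 1)),
      by rw [← map_pow, TriangleGroup.of_pow, map_one],
      by rw [← map_pow, TriangleGroup.of_pow, map_one], by
        rw [← inv_inj, ← inv_pow, ← TriangleGroup.map_of_two, ← map_pow,
          TriangleGroup.of_pow, map_one, inv_one]⟩) <| by
    constructor
    · intro f f' e
      have e := congrArg Subtype.val e
      exact TriangleGroup.hom_ext (congrArg Prod.fst e) (congrArg Prod.snd e)
    · rintro ⟨⟨x, y⟩, h0, h1, h2⟩
      have hrel : ∀ r ∈ triangleRels k, FreeGroup.lift ![x, y, (x * y)⁻¹] r = 1 := by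
        rintro r (⟨i, rfl⟩ | rfl)
        · fin_cases i
          · simpa using h0
          · simpa using h1
          · have : ((x * y)⁻¹) ^ k 2 = 1 := by rw [inv_pow, h2, inv_one]
            simpa using this
        · simp
      refine ⟨PresentedGroup.toGroup hrel, Subtype.ext (Prod.ext ?_ ?_)⟩
      · exact PresentedGroup.toGroup.of hrel
      · exact PresentedGroup.toGroup.of hrel

/-- If one of the three elements is trivial, the other two are equal or mutually inverse, and have
coprime orders. -/
theorem RelPairs.eq_one (hk_prime : ∀ i, (k i).Prime) (hk : Function.Injective k) {q : G × G}
    (hq : q ∈ RelPairs k G) (h : q.1 = 1 ∨ q.2 = 1 ∨ q.1 * q.2 = 1) : q = 1 := by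
  have hc : ∀ {i j : Fin 3}, i ≠ j → (k i).Coprime (k j) := fun hij =>
    (Nat.coprime_primes (hk_prime _) (hk_prime _)).2 (hk.ne hij)
  obtain ⟨x, y⟩ := q
  obtain ⟨h0, h1, h2⟩ := hq
  simp only at h h0 h1 h2
  rcases h with rfl | rfl | h
  · rw [one_mul] at h2
    rw [eq_one_of_pow_eq_one (hc (by decide)) h1 h2]
    rfl
  · rw [mul_one] at h2
    rw [eq_one_of_pow_eq_one (hc (by decide)) h0 h2]
    rfl
  · obtain rfl := eq_inv_of_mul_eq_one_left h
    rw [inv_pow, inv_eq_one] at h0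
    rw [eq_one_of_pow_eq_one (hc (by decide)) h0 h1, inv_one]
    rfl

theorem card_triangleGroup_hom [Finite G] (k : Fin 3 → ℕ) :
    Nat.card (TriangleGroup k →* G) = Nat.card {q // q ∈ RelPairs k G ∧ q ≠ 1} + 1 := by
  have h1 : (1 : G × G) ∈ RelPairs k G := by simp [RelPairs]
  rw [Nat.card_congr (TriangleGroup.homEquiv k G), Nat.card_coe_set_eq]
  have : Nat.card {q // q ∈ RelPairs k G ∧ q ≠ 1} = (RelPairs k G \ {1}).ncard := rfl
  rw [this, Set.ncard_sdiff_singleton_add_one h1]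

end TriangleGroup

/-! ### Descent to `PSL₂` and the final counts -/

section PSL

open Matrix

variable {p : ℕ} [Fact p.Prime]

/-- The projection from `SL₂` to `PSL₂`. -/
abbrev toPSLTwo (p : ℕ) : SpecialLinearGroup (Fin 2) (ZMod p) →* PSLTwo p :=
  QuotientGroup.mk' (Subgroup.center (SpecialLinearGroup (Fin 2) (ZMod p)))

/-- Pairs in `SL₂` whose traces, together with that of the product, satisfy the Chebyshev
conditions. -/
def ChebPairs (p : ℕ) (k : Fin 3 → ℕ) :
    Set (SpecialLinearGroup (Fin 2) (ZMod p) × SpecialLinearGroup (Fin 2) (ZMod p)) :=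
  {q | ChebRoot p (k 0) q.1.1.trace ∧ ChebRoot p (k 1) q.2.1.trace ∧
    ChebRoot p (k 2) (q.1 * q.2).1.trace}

variable {k : Fin 3 → ℕ}

theorem ChebPairs.fricke_ne_zero (h2 : (2 : ZMod p) ≠ 0) (hk_prime : ∀ i, (k i).Prime)
    (hk : Function.Injective k)
    {q : SpecialLinearGroup (Fin 2) (ZMod p) × SpecialLinearGroup (Fin 2) (ZMod p)}
    (hq : q ∈ ChebPairs p k) : fricke q.1.1.trace q.2.1.trace (q.1.1 * q.2.1).trace ≠ 0 :=
  fricke_ne_zero_of_chebRoot h2 (hk_prime 0) (hk_prime 1) (hk_prime 2) (hk.ne (by decide))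
    (hk.ne (by decide)) (hk.ne (by decide)) hq.1 hq.2.1 hq.2.2

theorem chebPairs_eq_preimage (h2 : (2 : ZMod p) ≠ 0) (hk_prime : ∀ i, (k i).Prime)
    (hk : Function.Injective k) :
    ChebPairs p k = MonoidHom.prodMap (toPSLTwo p) (toPSLTwo p) ⁻¹'
      {q | q ∈ RelPairs k (PSLTwo p) ∧ q ≠ 1} := by
  have hπ : ∀ {x : SpecialLinearGroup (Fin 2) (ZMod p)}, toPSLTwo p x = 1 ↔
      x ∈ Subgroup.center (SpecialLinearGroup (Fin 2) (ZMod p)) := fun {x} =>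
    QuotientGroup.eq_one_iff x
  ext ⟨x, y⟩
  change _ ↔ (toPSLTwo p x ^ k 0 = 1 ∧ toPSLTwo p y ^ k 1 = 1 ∧
    (toPSLTwo p x * toPSLTwo p y) ^ k 2 = 1) ∧ (toPSLTwo p x, toPSLTwo p y) ≠ 1
  constructor
  · intro hq
    have hf := ChebPairs.fricke_ne_zero h2 hk_prime hk hq
    simp only at hf
    rw [fricke_eq_cross_product_form x.2 y.2] at hf
    have hx : x ∉ Subgroup.center (SpecialLinearGroup (Fin 2) (ZMod p)) := by
      intro h
      obtain ⟨h1, h3, h4⟩ := SL2.mem_center_iff_entries.1 h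
      apply hf
      rw [h1, h3, h4]
      ring
    have hy : y ∉ Subgroup.center (SpecialLinearGroup (Fin 2) (ZMod p)) := by
      intro h
      obtain ⟨h1, h3, h4⟩ := SL2.mem_center_iff_entries.1 h
      apply hf
      rw [h1, h3, h4]
      ring
    -- If `x * y` were central, `x` would commute with `y`, hence be central itself.
    have hxy : x * y ∉ Subgroup.center (SpecialLinearGroup (Fin 2) (ZMod p)) := by
      intro h
      have hc : x * y = y * x := by
        have := Subgroup.mem_center_iff.1 h x
        rw [mul_assoc] at this
        exact mul_left_cancel this
      refine hx (SL2.mem_center_iff_entries.2 (scalar_of_commute x.2 y.2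
        (ChebPairs.fricke_ne_zero h2 hk_prime hk hq) rfl (congrArg Subtype.val hc)))
    rw [← map_pow, ← map_pow, ← map_mul, ← map_pow, hπ, hπ, hπ, ← chebRoot_trace_iff h2 hx,
      ← chebRoot_trace_iff h2 hy, ← chebRoot_trace_iff h2 hxy]
    exact ⟨hq, fun h => hx (hπ.1 (congrArg Prod.fst h))⟩
  · rintro ⟨hr, hne⟩
    have hn := mt (RelPairs.eq_one hk_prime hk (q := (toPSLTwo p x, toPSLTwo p y)) hr) hne
    simp only [not_or] at hn
    rw [← map_mul, hπ, hπ, hπ] at hn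
    rw [← map_pow, ← map_pow, ← map_mul, ← map_pow, hπ, hπ, hπ,
      ← chebRoot_trace_iff h2 hn.1, ← chebRoot_trace_iff h2 hn.2.1,
      ← chebRoot_trace_iff h2 hn.2.2] at hr
    exact hr

theorem card_chebPairs_eq_four_mul (h2 : (2 : ZMod p) ≠ 0) (hk_prime : ∀ i, (k i).Prime)
    (hk : Function.Injective k) :
    Nat.card (ChebPairs p k) =
      4 * Nat.card {q // q ∈ RelPairs k (PSLTwo p) ∧ q ≠ 1} := by
  have hs : Function.Surjective (toPSLTwo p) := QuotientGroup.mk'_surjective _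
  rw [chebPairs_eq_preimage h2 hk_prime hk, MonoidHom.card_preimage]
  · congr 1
    have : (MonoidHom.prodMap (toPSLTwo p) (toPSLTwo p)).ker =
        (toPSLTwo p).ker.prod (toPSLTwo p).ker := MonoidHom.ker_prodMap _ _
    rw [this, Nat.card_congr (Subgroup.prodEquiv _ _).toEquiv, Nat.card_prod,
      QuotientGroup.ker_mk', SL2.card_center h2]
  · exact hs.prodMap hs

theorem card_tracePairs_eq_card_SL (h2 : (2 : ZMod p) ≠ 0) {a b c : ZMod p}
    (h : fricke a b c ≠ 0) : Nat.card (TracePairs a b c) =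
      Nat.card (SpecialLinearGroup (Fin 2) (ZMod p)) := by
  have hodd : Fintype.card (ZMod p) % 2 = 1 := by
    rw [ZMod.card]
    refine (Nat.Prime.eq_two_or_odd Fact.out).resolve_left ?_
    rintro rfl
    exact h2 rfl
  refine Nat.eq_of_mul_eq_mul_left (Nat.card_pos (α := (ZMod p)ˣ)) ?_
  rw [← card_units_mul_card_tracePairs h2 hodd h, card_GL_eq_card_units_mul_card_SL]

theorem card_SL_two_zmod (p : ℕ) [Fact p.Prime] :
    Nat.card (SpecialLinearGroup (Fin 2) (ZMod p)) = p ^ 3 - p := by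
  have h1 : 1 ≤ p := (Fact.out : p.Prime).one_le
  have hu : Nat.card (ZMod p)ˣ = p - 1 := by
    rw [Nat.card_eq_fintype_card, ZMod.card_units]
  refine Nat.eq_of_mul_eq_mul_left (Nat.card_pos (α := (ZMod p)ˣ)) ?_
  rw [← card_GL_eq_card_units_mul_card_SL, Matrix.card_GL_field, Fin.prod_univ_two, hu, ZMod.card]
  have h3 : p ≤ p ^ 3 := Nat.le_self_pow (by norm_num) p
  have h4 : p ≤ p ^ 2 := Nat.le_self_pow (by norm_num) p
  have h5 : 1 ≤ p ^ 2 := h1.trans h4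
  simp only [Fin.val_zero, Fin.val_one, pow_zero, pow_one]
  zify [h1, h3, h4, h5]
  ring

theorem card_chebPairs (h2 : (2 : ZMod p) ≠ 0) (hk_prime : ∀ i, (k i).Prime)
    (hk : Function.Injective k) :
    Nat.card (ChebPairs p k) = Nat.card (ChebTriple p k) * (p ^ 3 - p) := by
  have e : ChebPairs p k ≃ Σ t : ChebTriple p k, TracePairs (t.1 0) (t.1 1) (t.1 2) :=
    { toFun := fun q => ⟨⟨![q.1.1.1.trace, q.1.2.1.trace, (q.1.1 * q.1.2).1.trace], by
        intro i
        fin_cases i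
        · exact q.2.1
        · exact q.2.2.1
        · exact q.2.2.2⟩, ⟨q.1, rfl, rfl, rfl⟩⟩
      invFun := fun q => ⟨q.2.1, by
        obtain ⟨t, q, h0, h1, h2⟩ := q
        refine ⟨?_, ?_, ?_⟩
        · rw [h0]; exact t.2 0
        · rw [h1]; exact t.2 1
        · rw [h2]; exact t.2 2⟩
      left_inv := fun q => rfl
      right_inv := by
        rintro ⟨⟨t, ht⟩, q, h0, h1, h2⟩
        simp only at h0 h1 h2
        have : t = ![q.1.1.trace, q.2.1.trace, (q.1 * q.2).1.trace] := by
          ext i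
          fin_cases i
          · exact h0.symm
          · exact h1.symm
          · exact h2.symm
        subst this
        rfl }
  have : Finite (ChebTriple p k) := Subtype.finite
  have := Fintype.ofFinite (ChebTriple p k)
  rw [Nat.card_congr e, Nat.card_sigma, Finset.sum_congr rfl fun t _ =>
    (card_tracePairs_eq_card_SL h2 (fricke_ne_zero_of_chebRoot h2 (hk_prime 0) (hk_prime 1)
      (hk_prime 2) (hk.ne (by decide)) (hk.ne (by decide)) (hk.ne (by decide)) (t.2 0) (t.2 1)
      (t.2 2))).trans (card_SL_two_zmod p), Finset.sum_const, smul_eq_mul, Finset.card_univ,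
    Nat.card_eq_fintype_card]

theorem ChebRoot.units_mul {n : ℕ} {t : ZMod p} (ht : ChebRoot p n t) (ε : ℤˣ) :
    ChebRoot p n (((ε : ℤ) : ZMod p) * t) := by
  rcases Int.units_eq_one_or ε with rfl | rfl
  · simpa using ht
  · simpa using ht.neg

theorem card_chebTriple (h2 : (2 : ZMod p) ≠ 0) (hk_odd : ∀ i, Odd (k i)) :
    Nat.card (ChebTriple p k) = 4 * Nat.card (ChebClasses p k) := by
  have h4 : Nat.card {ε : Fin 3 → ℤˣ // ∏ i, ε i = 1} = 4 := by
    rw [Nat.card_eq_fintype_card]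
    decide
  rw [← h4]
  refine Setoid.card_of_free (chebTripleSetoid p k) (fun ε t =>
    ⟨fun i => ((ε.1 i : ℤ) : ZMod p) * t.1 i, fun i => ChebRoot.units_mul (t.2 i) (ε.1 i)⟩) ?_ ?_
  · intro s t
    constructor
    · rintro ⟨ε, hε, h⟩
      exact ⟨⟨ε, hε⟩, Subtype.ext (funext h)⟩
    · rintro ⟨⟨ε, hε⟩, rfl⟩
      exact ⟨ε, hε, fun i => rfl⟩
  · intro t ε δ e
    refine Subtype.ext (funext fun i => ?_)
    have h := mul_right_cancel₀ (ChebRoot.ne_zero h2 (hk_odd i) (t.2 i))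
      (congrFun (congrArg Subtype.val e) i)
    have h11 : (1 : ZMod p) ≠ -1 := fun h => h2 (by linear_combination h)
    rcases Int.units_eq_one_or (ε.1 i) with h1 | h1 <;>
      rcases Int.units_eq_one_or (δ.1 i) with h3 | h3 <;> rw [h1, h3] at h ⊢
    · exact absurd (by simpa using h) h11
    · exact absurd (by simpa using h.symm) h11

theorem card_nontrivial_relPairs (h2 : (2 : ZMod p) ≠ 0) (hk_prime : ∀ i, (k i).Prime)
    (hk_odd : ∀ i, Odd (k i)) (hk : Function.Injective k) :
    Nat.card {q // q ∈ RelPairs k (PSLTwo p) ∧ q ≠ 1} =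
      (p ^ 3 - p) * Nat.card (ChebClasses p k) := by
  have h := card_chebPairs_eq_four_mul h2 hk_prime hk
  rw [card_chebPairs h2 hk_prime hk, card_chebTriple h2 hk_odd] at h
  refine Nat.eq_of_mul_eq_mul_left (by norm_num : 0 < 4) ?_
  rw [← h]
  ring

/-- Lifts of commuting elements commute up to sign, and the sign `-1` would make `x` conjugate to
`-x`, of opposite trace. -/
theorem commute_of_toPSLTwo_commute (h2 : (2 : ZMod p) ≠ 0)
    {g x : SpecialLinearGroup (Fin 2) (ZMod p)} (hx : x.1.trace ≠ 0)
    (h : toPSLTwo p g * toPSLTwo p x = toPSLTwo p x * toPSLTwo p g) : g * x = x * g := by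
  rw [← map_mul, ← map_mul] at h
  have hc := SL2.mem_center_iff_eq.1 (QuotientGroup.eq.1 h)
  rw [inv_mul_eq_iff_eq_mul, inv_mul_eq_iff_eq_mul, mul_one] at hc
  rcases hc with hc | hc
  · exact hc.symm
  · exfalso
    have h1 : g⁻¹ * x * g = -x := by
      rw [mul_assoc, hc]
      simp
    have h3 : (g⁻¹ * x * g).1.trace = x.1.trace := by
      have : (g⁻¹ * x * g).1 = g⁻¹.1 * x.1 * g.1 := rfl
      rw [this, Matrix.trace_mul_comm, ← mul_assoc]
      have h4 : g.1 * g⁻¹.1 = 1 := congrArg Subtype.val (mul_inv_cancel g)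
      rw [h4, one_mul]
    rw [h1] at h3
    have h5 : (-x).1.trace = -x.1.trace := by
      rw [← Matrix.trace_neg]
      rfl
    rw [h5] at h3
    have h6 : 2 * x.1.trace = 0 := by linear_combination -h3
    exact (mul_ne_zero h2 hx) h6

theorem eq_one_of_commute_relPairs (h2 : (2 : ZMod p) ≠ 0) (hk_prime : ∀ i, (k i).Prime)
    (hk_odd : ∀ i, Odd (k i)) (hk : Function.Injective k) {X Y h : PSLTwo p}
    (hr : (X, Y) ∈ RelPairs k (PSLTwo p)) (hne : (X, Y) ≠ 1) (hX : h * X = X * h)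
    (hY : h * Y = Y * h) : h = 1 := by
  have hs : Function.Surjective (toPSLTwo p) := QuotientGroup.mk'_surjective _
  obtain ⟨x, rfl⟩ := hs X
  obtain ⟨y, rfl⟩ := hs Y
  obtain ⟨g, rfl⟩ := hs h
  have hq : (x, y) ∈ ChebPairs p k := by
    rw [chebPairs_eq_preimage h2 hk_prime hk]
    exact ⟨hr, hne⟩
  have hx := commute_of_toPSLTwo_commute h2 (hq.1.ne_zero h2 (hk_odd 0)) hX
  have hy := commute_of_toPSLTwo_commute h2 (hq.2.1.ne_zero h2 (hk_odd 1)) hY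
  refine (QuotientGroup.eq_one_iff g).2 (SL2.mem_center_iff_entries.2
    (scalar_of_commute x.2 y.2 (ChebPairs.fricke_ne_zero h2 hk_prime hk hq) (congrArg Subtype.val hx)
      (congrArg Subtype.val hy)))

theorem card_PSLTwo_mul_two (h2 : (2 : ZMod p) ≠ 0) : Nat.card (PSLTwo p) * 2 = p ^ 3 - p := by
  rw [← card_SL_two_zmod]
  conv_lhs => rw [← SL2.card_center h2]
  exact (Subgroup.card_eq_card_quotient_mul_card_subgroup
    (Subgroup.center (SpecialLinearGroup (Fin 2) (ZMod p)))).symm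

theorem card_homModConj (h2 : (2 : ZMod p) ≠ 0) (hk_prime : ∀ i, (k i).Prime)
    (hk_odd : ∀ i, Odd (k i)) (hk : Function.Injective k) :
    Nat.card (HomModConj (TriangleGroup k) (PSLTwo p)) = 2 * Nat.card (ChebClasses p k) + 1 := by
  let s := homConj (TriangleGroup k) (PSLTwo p)
  have hfin : Finite (TriangleGroup k →* PSLTwo p) :=
    Finite.of_equiv _ (TriangleGroup.homEquiv k (PSLTwo p)).symm
  have hmk : ∀ f, Quotient.mk s f = Quotient.mk s 1 ↔ f = 1 := by
    intro f
    constructor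
    · intro e
      obtain ⟨g, hg⟩ := s.symm (Quotient.exact e)
      exact MonoidHom.ext fun x => by simpa using hg x
    · rintro rfl
      rfl
  have h := Setoid.card_preimage_of_free s (fun g f => (MulAut.conj g).toMonoidHom.comp f)
    (fun f f' => by
      constructor
      · rintro ⟨g, hg⟩
        exact ⟨g, MonoidHom.ext hg⟩
      · rintro ⟨g, rfl⟩
        exact ⟨g, fun x => rfl⟩) {Quotient.mk s 1}ᶜ (by
      intro f hf g g' e
      have hf : f ≠ 1 := fun h => hf ((hmk f).2 h)
      -- Freeness: `g'⁻¹ * g` centralizes the image of the nontrivial `f`, so it is trivial.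
      have hcomm : ∀ x, g'⁻¹ * g * f x = f x * (g'⁻¹ * g) := by
        intro x
        have := DFunLike.congr_fun e x
        change g * f x * g⁻¹ = g' * f x * g'⁻¹ at this
        rw [mul_inv_eq_iff_eq_mul] at this
        rw [mul_assoc, this]
        group
      have := eq_one_of_commute_relPairs h2 hk_prime hk_odd hk
        (TriangleGroup.homEquiv k (PSLTwo p) f).2 (fun h => hf ?_) (hcomm _) (hcomm _)
      · exact (inv_mul_eq_one.1 this).symm
      · exact TriangleGroup.hom_ext (congrArg Prod.fst h) (congrArg Prod.snd h))
  have hX : Nat.card {f // Quotient.mk s f ∈ ({Quotient.mk s 1}ᶜ : Set _)} + 1 =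
      Nat.card (TriangleGroup k →* PSLTwo p) := by
    have : Nat.card {f // Quotient.mk s f ∈ ({Quotient.mk s 1}ᶜ : Set _)} =
        (Set.univ \ {(1 : TriangleGroup k →* PSLTwo p)}).ncard := by
      rw [← Nat.card_coe_set_eq]
      exact Nat.card_congr (Equiv.subtypeEquivRight fun f => by simp [hmk])
    rw [this, Set.ncard_sdiff_singleton_add_one (Set.mem_univ _), Set.ncard_univ]
  have hQ : Nat.card ({Quotient.mk s 1}ᶜ : Set (Quotient s)) + 1 = Nat.card (Quotient s) := by
    rw [Nat.card_coe_set_eq, ← Set.ncard_add_ncard_compl {Quotient.mk s 1},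
      Set.ncard_singleton, add_comm]
  rw [card_triangleGroup_hom, card_nontrivial_relPairs h2 hk_prime hk_odd hk,
    ← card_PSLTwo_mul_two h2] at hX
  change Nat.card (Quotient s) = _
  rw [← hQ]
  congr 1
  -- Each nontrivial class has `|PSL₂|` elements, and there are `2 * |PSL₂| * |𝒜|` nontrivial
  -- homomorphisms.
  refine Nat.eq_of_mul_eq_mul_left (Nat.card_pos (α := PSLTwo p)) ?_
  rw [← h, Nat.add_right_cancel hX]
  ring

end PSL

theorem mainTheorem3 (p : ℕ) (hp : p.Prime) (hp_odd : Odd p)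
    (k : Fin 3 → ℕ) (hk_prime : ∀ i, (k i).Prime) (hk_odd : ∀ i, Odd (k i))
    (hk_distinct : Function.Injective k) (hk_dvd : ∀ i, k i ∣ Nat.card (PSLTwo p)) :
    Nat.card (HomModConj (TriangleGroup k) (PSLTwo p)) = 2 * Nat.card (ChebClasses p k) + 1 ∧
      Nat.card (TriangleGroup k →* PSLTwo p) = (p ^ 3 - p) * Nat.card (ChebClasses p k) + 1 := by
  have : Fact p.Prime := ⟨hp⟩
  have h2 : (2 : ZMod p) ≠ 0 := by
    intro h
    have h' : ((2 : ℕ) : ZMod p) = 0 := by exact_mod_cast h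
    rw [ZMod.natCast_eq_zero_iff, Nat.prime_dvd_prime_iff_eq hp Nat.prime_two] at h'
    subst h'
    exact absurd hp_odd (by decide)
  exact ⟨card_homModConj h2 hk_prime hk_odd hk_distinct, by
    rw [card_triangleGroup_hom, card_nontrivial_relPairs h2 hk_prime hk_odd hk_distinct]⟩
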